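/- Let $X$ be a proper CAT(0) space. A geodesic in $X$ is an isometric embedding $v\colon\mathbb{R}\to X$; let $GX$ be the set of all geodesics in $X$ with the compact-open topology. For $v\in GX$ let $\mathcal{P}_v\subseteq GX$ be the set of geodesics parallel to $v$ (those $w$ for which $t\mapsto d(v(t),w(t))$ is constant), and let $P_v\subseteq X$ be the set of points lying on some $w\in\mathcal{P}_v$. Let $C_v\subseteq P_v$ be the cross section of $v$, i.e. the set of all $x\in P_v$ whose nearest point on $v(\mathbb{R})$ is $v(0)$ (so that $P_v$ splits isometrically as $C_v\times\mathbb{R}$), and put $\mathcal{CS}_v=\{w\in\mathcal{P}_v : w(0)\in C_v\}$. Call $v$ completely approachable if for every $x\in C_v$ and every sequence $v_n\to v$ in $GX$ there is a sequence $x_n\to x$ in $X$ with $x_n\in C_{v_n}$ for all $n$. Let $\overline{GX}=GX\cup\{\infty\}$ be the one-point compactification of $GX$, and let $\mathcal{C}(\overline{GX})$ be the space of its closed subsets with the Hausdorff topology. Then: 1. The completely approachable geodesics form a dense $G_\delta$ set in $GX$. 2. The extended cross-section map $\overline{\mathcal{CS}}\colon GX\to\mathcal{C}(\overline{GX})$,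 $\overline{\mathcal{CS}}(w)=\mathcal{CS}_w\cup\{\infty\}$, is upper semicontinuous: for every $v\in GX$ and every open $U\supseteq\overline{\mathcal{CS}}(v)$ one has $\overline{\mathcal{CS}}(w)\subseteq U$ for all $w$ in some neighbourhood of $v$. 3. A geodesic $v\in GX$ is completely approachable if and only if $\overline{\mathcal{CS}}$ is continuous at $v$. -/

import Mathlib

open Set Filter Topology TopologicalSpace

/-- `σ`, restricted to `[0, dist x y]`, is a geodesic segment from `x` to `y`, parametrized by
arc length; the values of `σ` outside `[0, dist x y]` are irrelevant. -/
def IsGeodesicSegment {X : Type*} [MetricSpace X] (σ : ℝ → X) (x y : X) : Prop :=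
  σ 0 = x ∧ σ (dist x y) = y ∧
    ∀ s ∈ Icc 0 (dist x y), ∀ t ∈ Icc 0 (dist x y), dist (σ s) (σ t) = |s - t|

/-- A CAT(0) space: a uniquely geodesic metric space in which every geodesic triangle is no fatter
than its comparison triangle in the Euclidean plane. In `comparison`, `x' y' z'` is a comparison
triangle for `x y z`, and `p'`, `q'` are the comparison points of the points `σ s` on the side
`[x, y]` and `τ t` on the side `[x, z]`. -/
structure IsCAT0 (X : Type*) [MetricSpace X] : Prop where
  exists_geodesic : ∀ x y : X, ∃ σ : ℝ → X, IsGeodesicSegment σ x y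
  unique_geodesic : ∀ (x y : X) (σ τ : ℝ → X), IsGeodesicSegment σ x y →
    IsGeodesicSegment τ x y → EqOn σ τ (Icc 0 (dist x y))
  comparison : ∀ (x y z : X) (σ τ : ℝ → X), IsGeodesicSegment σ x y → IsGeodesicSegment τ x z →
    ∀ x' y' z' : EuclideanSpace ℝ (Fin 2),
      dist x' y' = dist x y → dist x' z' = dist x z → dist y' z' = dist y z →
    ∀ s ∈ Icc 0 (dist x y), ∀ t ∈ Icc 0 (dist x z),
    ∀ p' ∈ segment ℝ x' y', ∀ q' ∈ segment ℝ x' z', dist x' p' = s → dist x' q' = t →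
      dist (σ s) (τ t) ≤ dist p' q'

/-- The space `GX` of geodesics in `X`, i.e. isometric embeddings `ℝ → X`, with the
compact-open topology (the subspace topology from `C(ℝ, X)`). -/
abbrev GeodesicSpace (X : Type*) [MetricSpace X] : Type _ := {v : C(ℝ, X) // Isometry v}

namespace GeodesicSpace

variable {X : Type*} [MetricSpace X]

/-- The geodesic `w` is parallel to `v`: the distance `d(v(t), w(t))` does not depend on `t`. -/
def Parallel (v w : GeodesicSpace X) : Prop :=
  ∃ c : ℝ, ∀ t : ℝ, dist (v.1 t) (w.1 t) = c

/-- The parallel set of `v` in `GX`. -/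
def parallelSet (v : GeodesicSpace X) : Set (GeodesicSpace X) := {w | Parallel v w}

/-- The parallel set `P_v` of `v` in `X`: the points that lie on some geodesic parallel to `v`. -/
def parallelPoints (v : GeodesicSpace X) : Set X := {x | ∃ w ∈ parallelSet v, x ∈ range w.1}

/-- The cross section `C_v` of `v` in `X`: the points of `P_v` whose nearest point on the line
`v(ℝ)` is `v(0)`, i.e. the fibre over `v(0)` of the nearest-point projection `P_v → v(ℝ)`.
It is the factor through `v(0)` of the splitting `P_v = C_v × ℝ`: see
`crossSection_eq_of_splitting`. -/
def crossSection (v : GeodesicSpace X) : Set X :=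
  {x | x ∈ parallelPoints v ∧ ∀ t : ℝ, dist x (v.1 0) ≤ dist x (v.1 t)}

/-- If `C` contains `v(0)` and `P_v` splits isometrically as the `ℓ²`-product `C × ℝ`, where `C`
is the slice at height `0` and the lines `{c} × ℝ` are the geodesics parallel to `v`, then `C` is
the cross section of `v`. -/
theorem crossSection_eq_of_splitting (v : GeodesicSpace X) (C : Set X) (h0 : v.1 0 ∈ C)
    (φ : C × ℝ → X) (hrange : range φ = parallelPoints v)
    (hdist : ∀ p q : C × ℝ, dist (φ p) (φ q) ^ 2 = dist p.1 q.1 ^ 2 + (p.2 - q.2) ^ 2)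
    (hslice : ∀ c : C, φ (c, 0) = c)
    (hpar : ∀ c : C, ∃ w ∈ parallelSet v, ∀ t : ℝ, w.1 t = φ (c, t)) :
    crossSection v = C := by
  have hv : ∀ t, v.1 t = φ (⟨v.1 0, h0⟩, t) := by
    obtain ⟨w, ⟨c, hc⟩, hw⟩ := hpar ⟨v.1 0, h0⟩
    intro t
    have h1 := hc 0
    rw [hw 0, hslice] at h1
    simp only [dist_self] at h1
    rw [← hw t, ← dist_eq_zero, hc t, h1]
  ext x
  constructor
  · rintro ⟨hx, hmin⟩
    rw [← hrange] at hx
    obtain ⟨⟨c, s⟩, rfl⟩ := hx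
    have h1 := pow_le_pow_left₀ dist_nonneg (hmin s) 2
    have h2 := hv s
    have h3 := hv 0
    generalize v.1 s = a at h1 h2
    generalize hb : φ (⟨v.1 0, h0⟩, 0) = b at h3
    rw [h3, ← hb, h2, hdist, hdist] at h1
    have hs : s = 0 := by
      simp only [sub_zero, sub_self] at h1
      nlinarith [sq_nonneg s]
    subst hs
    rw [hslice]
    exact c.2
  · intro hx
    refine ⟨hrange ▸ ⟨(⟨x, hx⟩, 0), hslice ⟨x, hx⟩⟩, fun t => ?_⟩
    have h1 := hdist (⟨x, hx⟩, 0) (⟨v.1 0, h0⟩, 0)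
    have h2 := hdist (⟨x, hx⟩, 0) (⟨v.1 0, h0⟩, t)
    rw [← hv, hslice] at h1 h2
    refine (sq_le_sq₀ dist_nonneg dist_nonneg).1 ?_
    rw [h1, h2]
    nlinarith [sq_nonneg t]

/-- The cross section `CS_v` of `v` in `GX`. -/
def crossSectionG (v : GeodesicSpace X) : Set (GeodesicSpace X) :=
  {w | w ∈ parallelSet v ∧ w.1 0 ∈ crossSection v}

/-- `v` is completely approachable. -/
def CompletelyApproachable (v : GeodesicSpace X) : Prop :=
  ∀ x ∈ crossSection v, ∀ u : ℕ → GeodesicSpace X, Tendsto u atTop (𝓝 v) →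
    ∃ y : ℕ → X, Tendsto y atTop (𝓝 x) ∧ ∀ n, y n ∈ crossSection (u n)

theorem continuous_eval (t : ℝ) : Continuous fun w : GeodesicSpace X => w.1 t :=
  (ContinuousEvalConst.continuous_eval_const t).comp continuous_subtype_val

theorem isClosed_crossSectionG (v : GeodesicSpace X) : IsClosed (crossSectionG v) := by
  have h : crossSectionG v =
      (⋂ t : ℝ, {w | dist (v.1 t) (w.1 t) = dist (v.1 0) (w.1 0)}) ∩
        ⋂ t : ℝ, {w | dist (w.1 0) (v.1 0) ≤ dist (w.1 0) (v.1 t)} := by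
    ext w
    simp only [mem_inter_iff, mem_iInter]
    constructor
    · rintro ⟨⟨c, hc⟩, -, h2⟩
      exact ⟨fun t => (hc t).trans (hc 0).symm, h2⟩
    · rintro ⟨h1, h2⟩
      have hw : w ∈ parallelSet v := ⟨_, h1⟩
      exact ⟨hw, ⟨w, hw, mem_range_self 0⟩, h2⟩
  rw [h]
  refine (isClosed_iInter fun t => ?_).inter (isClosed_iInter fun t => ?_)
  · exact isClosed_eq (continuous_const.dist (continuous_eval t))
      (continuous_const.dist (continuous_eval 0))
  · exact isClosed_le ((continuous_eval 0).dist continuous_const)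
      ((continuous_eval 0).dist continuous_const)

/-- The extended cross section `CS_v ∪ {∞}`, a closed subset of the one-point compactification
of `GX`. -/
def extCrossSection (v : GeodesicSpace X) : Closeds (OnePoint (GeodesicSpace X)) where
  carrier := (fun w : GeodesicSpace X => (w : OnePoint (GeodesicSpace X))) '' crossSectionG v ∪
    {OnePoint.infty}
  isClosed' := by
    rw [OnePoint.isClosed_iff_of_mem (by simp)]
    convert isClosed_crossSectionG v using 1
    ext w
    simp

/-- Sets of geodesics with bounded footpoints `w(0)` are relatively compact, so `GX` is locally compact
and its one-point compactification is Hausdorff. -/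
instance [ProperSpace X] : WeaklyLocallyCompactSpace (GeodesicSpace X) where
  exists_compact_mem_nhds v := by
    refine ⟨{w | dist (w.1 0) (v.1 0) ≤ 1}, ?_, ?_⟩
    · rw [Subtype.isCompact_iff]
      refine ArzelaAscoli.isCompact_of_equicontinuous _ ?_ ?_
      · have hK : IsCompact (Set.pi univ fun t : ℝ => Metric.closedBall (v.1 0) (|t| + 1)) :=
          isCompact_univ_pi fun t => isCompact_closedBall _ _
        refine hK.of_isClosed_subset ?_ ?_
        · have h : ContinuousMap.toFun ''
              (Subtype.val '' {w : GeodesicSpace X | dist (w.1 0) (v.1 0) ≤ 1}) =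
              (⋂ s : ℝ, ⋂ t : ℝ, {f : ℝ → X | dist (f s) (f t) = dist s t}) ∩
                {f : ℝ → X | dist (f 0) (v.1 0) ≤ 1} := by
            ext f
            simp only [mem_inter_iff, mem_iInter]
            constructor
            · rintro ⟨_, ⟨w, hw, rfl⟩, rfl⟩
              exact ⟨fun s t => w.2.dist_eq s t, hw⟩
            · rintro ⟨h1, h2⟩
              have hf : Isometry f := Isometry.of_dist_eq h1
              exact ⟨⟨f, hf.continuous⟩, ⟨⟨⟨f, hf.continuous⟩, hf⟩, h2, rfl⟩, rfl⟩
          rw [h]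
          refine (isClosed_iInter fun s => isClosed_iInter fun t => ?_).inter ?_
          · exact isClosed_eq ((continuous_apply s).dist (continuous_apply t)) continuous_const
          · exact isClosed_le ((continuous_apply 0).dist continuous_const) continuous_const
        · rintro _ ⟨_, ⟨w, hw, rfl⟩, rfl⟩ t -
          have h1 : dist (w.1 t) (w.1 0) = |t| := by rw [w.2.dist_eq, Real.dist_eq, sub_zero]
          have h2 : dist (w.1 0) (v.1 0) ≤ 1 := hw
          exact (dist_triangle (w.1 t) (w.1 0) (v.1 0)).trans (by rw [h1]; linarith)
      · refine Metric.equicontinuous_of_continuity_modulus id tendsto_id _ ?_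
        rintro s t ⟨_, w, -, rfl⟩
        exact (w.2.dist_eq s t).le
    · refine mem_of_superset ((isOpen_lt ((continuous_eval 0).dist continuous_const)
        continuous_const).mem_nhds (x := v) ?_) fun w (hw : dist (w.1 0) (v.1 0) < 1) => hw.le
      simp

end GeodesicSpace

/-- The Hausdorff topology on the space of closed subsets of a compact Hausdorff space `Z`: the
topology of the Hausdorff uniformity for the unique uniform structure of `Z`. If `Z` is metrizable,
this is the topology of the Hausdorff distance of any metric that induces the topology of `Z`. -/
abbrev hausdorffTopology (Z : Type*) [TopologicalSpace Z] [CompactSpace Z] [T2Space Z] :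
    TopologicalSpace (Closeds Z) :=
  letI : UniformSpace Z := uniformSpaceOfCompactR1
  (Closeds.uniformSpace : UniformSpace (Closeds Z)).toTopologicalSpace

/-! The graph of `crossSectionG` is closed, being cut out by closed conditions on distances, and
geodesics with footpoint in a ball form a compact set (Arzelà–Ascoli). So the geodesics whose cross
section meets a given compact set form a closed set (`isClosed_setOf_crossSectionG_inter`);
complements of neighbourhoods of `∞` being compact, this is upper semicontinuity. For the Hausdorff
topology, continuity is upper plus lower hemicontinuity. The upper half is automatic; the lower half
is complete approachability, carried from `X` to `GX` by the footpoint map `w ↦ w(0)`. CAT(0)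
convexity of the distance makes this map a bijection from `CS_v` to `C_v`. Failure of
approachability is detected by countably many balls, each confining it to the frontier of a closed
set, so Baire's theorem applies. -/

/-! ### Convexity of the distance in CAT(0) spaces -/

/-- Three numbers satisfying the triangle inequalities are the side lengths of a triangle in the
Euclidean plane. -/
theorem exists_euclidean_triangle {a b c : ℝ} (ha : 0 ≤ a) (hb : 0 ≤ b) (hc : 0 ≤ c)
    (hab : c ≤ a + b) (hbc : a ≤ b + c) (hac : b ≤ a + c) :
    ∃ x y z : EuclideanSpace ℝ (Fin 2), dist x y = a ∧ dist x z = b ∧ dist y z = c := by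
  -- `u` is the first coordinate of the third vertex, from the law of cosines; `u ^ 2 ≤ b ^ 2`
  -- encodes the triangle inequalities.
  obtain ⟨u, hu, hub⟩ : ∃ u : ℝ, 2 * a * u = a ^ 2 + b ^ 2 - c ^ 2 ∧ u ^ 2 ≤ b ^ 2 := by
    rcases ha.eq_or_lt with rfl | ha'
    · have h : b = c := by linarith
      exact ⟨0, by rw [h]; ring, by simpa using sq_nonneg b⟩
    · refine ⟨(a ^ 2 + b ^ 2 - c ^ 2) / (2 * a), by field_simp, ?_⟩
      refine sq_le_sq' ?_ ?_
      · rw [le_div_iff₀ (by positivity)]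
        nlinarith
      · rw [div_le_iff₀ (by positivity)]
        nlinarith
  have hs : √(b ^ 2 - u ^ 2) ^ 2 = b ^ 2 - u ^ 2 := Real.sq_sqrt (by linarith)
  refine ⟨!₂[0, 0], !₂[a, 0], !₂[u, √(b ^ 2 - u ^ 2)], ?_, ?_, ?_⟩
  · simp [EuclideanSpace.dist_eq, Real.dist_eq, Real.sqrt_sq ha]
  · simp [EuclideanSpace.dist_eq, Real.dist_eq, hs, Real.sqrt_sq hb]
  · simp only [EuclideanSpace.dist_eq, Real.dist_eq, Fin.sum_univ_two, Matrix.cons_val_zero,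
      Matrix.cons_val_one, sq_abs, zero_sub, even_two, Even.neg_pow, hs]
    rw [show (a - u) ^ 2 + (b ^ 2 - u ^ 2) = c ^ 2 by linarith, Real.sqrt_sq hc]

/-- A bounded midpoint-convex function on the line is constant. -/
theorem eq_of_midpoint_convex_of_bddAbove {f : ℝ → ℝ} {M : ℝ} (hM : ∀ t, f t ≤ M)
    (hf : ∀ a b, f ((a + b) / 2) ≤ (f a + f b) / 2) (s t : ℝ) : f s = f t := by
  have key : ∀ s h, f (s + h) ≤ f s := by
    intro s h
    by_contra! hlt
    -- By convexity, doubling the step at least doubles the increase, so any increase is eventually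
    -- unbounded.
    have hgrow : ∀ n : ℕ, 2 ^ n * (f (s + h) - f s) ≤ f (s + 2 ^ n * h) - f s := by
      intro n
      induction n with
      | zero => simp
      | succ n ih =>
        have h1 := hf s (s + 2 ^ (n + 1) * h)
        rw [show (s + (s + 2 ^ (n + 1) * h)) / 2 = s + 2 ^ n * h by ring] at h1
        rw [pow_succ]
        rw [pow_succ] at h1
        linarith
    obtain ⟨n, hn⟩ := pow_unbounded_of_one_lt ((M - f s) / (f (s + h) - f s)) one_lt_two
    rw [div_lt_iff₀ (by linarith)] at hn
    linarith [hgrow n, hM (s + 2 ^ n * h)]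
  refine le_antisymm ?_ ?_
  · simpa using key t (s - t)
  · simpa using key s (t - s)

section CAT0

variable {X : Type*} [MetricSpace X]

theorem IsGeodesicSegment.reverse {σ : ℝ → X} {x y : X} (h : IsGeodesicSegment σ x y) :
    IsGeodesicSegment (fun t => σ (dist x y - t)) y x := by
  obtain ⟨h0, h1, h2⟩ := h
  refine ⟨by simpa using h1, by simpa [dist_comm y x] using h0, fun s hs t ht => ?_⟩
  rw [dist_comm y x] at hs ht
  rw [h2 _ ⟨by linarith [hs.2], by linarith [hs.1]⟩ _ ⟨by linarith [ht.2], by linarith [ht.1]⟩,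
    abs_sub_comm]
  congr 1
  ring

/-- In a CAT(0) space the midpoints of two sides of a triangle are at distance at most half the
third side. -/
theorem IsCAT0.dist_midpoint_le (hX : IsCAT0 X) {x y z : X} {σ τ : ℝ → X}
    (hσ : IsGeodesicSegment σ x y) (hτ : IsGeodesicSegment τ x z) :
    dist (σ (dist x y / 2)) (τ (dist x z / 2)) ≤ dist y z / 2 := by
  obtain ⟨x', y', z', hxy, hxz, hyz⟩ := exists_euclidean_triangle (a := dist x y) (b := dist x z)
    (c := dist y z) dist_nonneg dist_nonneg dist_nonneg (dist_triangle_left y z x)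
    ((dist_triangle x z y).trans_eq (by rw [dist_comm z y])) (dist_triangle x y z)
  have h1 : (0 : ℝ) ≤ dist x y := dist_nonneg
  have h2 : (0 : ℝ) ≤ dist x z := dist_nonneg
  refine (hX.comparison x y z σ τ hσ hτ x' y' z' hxy hxz hyz _ ⟨by linarith, by linarith⟩ _
    ⟨by linarith, by linarith⟩ (midpoint ℝ x' y') (midpoint_mem_segment _ _) (midpoint ℝ x' z')
    (midpoint_mem_segment _ _) ?_ ?_).trans ?_
  · rw [dist_left_midpoint, hxy, Real.norm_ofNat]
    ring
  · rw [dist_left_midpoint, hxz, Real.norm_ofNat]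
    ring
  · refine (dist_midpoint_midpoint_le x' y' x' z').trans_eq ?_
    rw [dist_self, hyz, zero_add]

/-! ### Parallel geodesics and their footpoints -/

namespace GeodesicSpace

theorem isGeodesicSegment (v : GeodesicSpace X) {a b : ℝ} (hab : a ≤ b) :
    IsGeodesicSegment (fun t => v.1 (a + t)) (v.1 a) (v.1 b) := by
  have h : dist (v.1 a) (v.1 b) = b - a := by
    rw [v.2.dist_eq, Real.dist_eq, abs_sub_comm, abs_of_nonneg (by linarith)]
  refine ⟨by simp, by simp [h], fun s _ t _ => ?_⟩
  rw [v.2.dist_eq, Real.dist_eq]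
  congr 1
  ring

/-- The distance between two geodesics of a CAT(0) space is a midpoint-convex function. -/
theorem dist_midpoint_le (hX : IsCAT0 X) (v w : GeodesicSpace X) (a b : ℝ) :
    dist (v.1 ((a + b) / 2)) (w.1 ((a + b) / 2)) ≤
      (dist (v.1 a) (w.1 a) + dist (v.1 b) (w.1 b)) / 2 := by
  wlog hab : a ≤ b generalizing a b
  · rw [add_comm a b, add_comm (dist (v.1 a) _)]
    exact this b a (by linarith)
  -- The diagonal `σ` cuts the quadrilateral into two triangles, with apexes `v(a)` and `w(b)`; the
  -- midpoint estimates meet at the midpoint of `σ`.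
  obtain ⟨σ, hσ⟩ := hX.exists_geodesic (v.1 a) (w.1 b)
  have h1 := hX.dist_midpoint_le (v.isGeodesicSegment hab) hσ
  have h2 := hX.dist_midpoint_le hσ.reverse (w.isGeodesicSegment hab).reverse
  have hd (u : GeodesicSpace X) : dist (u.1 a) (u.1 b) = b - a := by
    rw [u.2.dist_eq, Real.dist_eq, abs_sub_comm, abs_of_nonneg (by linarith)]
  simp only [dist_comm (w.1 b) (v.1 a), dist_comm (w.1 b) (w.1 a), hd, sub_half] at h1 h2
  rw [show a + (b - a) / 2 = (a + b) / 2 by ring] at h1 h2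
  linarith [dist_triangle (v.1 ((a + b) / 2)) (σ (dist (v.1 a) (w.1 b) / 2)) (w.1 ((a + b) / 2))]

/-- Geodesics of a CAT(0) space at bounded distance from each other are parallel. -/
theorem parallel_of_dist_le (hX : IsCAT0 X) {v w : GeodesicSpace X} {M : ℝ}
    (h : ∀ t, dist (v.1 t) (w.1 t) ≤ M) : Parallel v w :=
  ⟨dist (v.1 0) (w.1 0), fun t =>
    eq_of_midpoint_convex_of_bddAbove h (dist_midpoint_le hX v w) t 0⟩

theorem eq_of_parallel (hX : IsCAT0 X) {u v w : GeodesicSpace X} (hv : Parallel u v)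
    (hw : Parallel u w) (h0 : v.1 0 = w.1 0) : v = w := by
  obtain ⟨c, hc⟩ := hv
  obtain ⟨d, hd⟩ := hw
  obtain ⟨e, he⟩ := parallel_of_dist_le hX (v := v) (w := w) (M := c + d) fun t => by
    rw [← hc t, ← hd t]
    exact dist_triangle_left _ _ _
  have h : e = 0 := by rw [← he 0, h0, dist_self]
  exact Subtype.ext (ContinuousMap.ext fun t => dist_eq_zero.1 ((he t).trans h))

/-- Every point of the cross section of `v` in `X` is the footpoint of a geodesic in the cross
section of `v` in `GX`. -/
theorem exists_crossSectionG (hX : IsCAT0 X) {v : GeodesicSpace X} {x : X}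
    (hx : x ∈ crossSection v) : ∃ w ∈ crossSectionG v, w.1 0 = x := by
  obtain ⟨w, ⟨c, hc⟩, s, rfl⟩ := hx.1
  -- Shifting time by `s` puts the footpoint at the given point and moves each point by `|s|`, so
  -- the distance to `v` stays bounded.
  let w' : GeodesicSpace X := ⟨⟨fun t => w.1 (t + s), by fun_prop⟩,
    w.2.comp (IsometryEquiv.addRight s).isometry⟩
  have h0 : w'.1 0 = w.1 s := congrArg w.1 (zero_add s)
  refine ⟨w', ⟨parallel_of_dist_le hX (M := c + |s|) fun t => ?_, h0 ▸ hx⟩, h0⟩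
  refine (dist_triangle _ (w.1 t) _).trans_eq ?_
  rw [hc t, show w'.1 t = w.1 (t + s) from rfl, w.2.dist_eq, Real.dist_eq, sub_add_cancel_left,
    abs_neg]

theorem self_mem_crossSection (v : GeodesicSpace X) : v.1 0 ∈ crossSection v :=
  ⟨⟨v, ⟨0, fun _ => dist_self _⟩, mem_range_self 0⟩, fun t => by simp⟩

/-! ### Closed graph and compactness -/

theorem isClosed_graph_crossSectionG :
    IsClosed {p : GeodesicSpace X × GeodesicSpace X | p.2 ∈ crossSectionG p.1} := by
  have h : {p : GeodesicSpace X × GeodesicSpace X | p.2 ∈ crossSectionG p.1} =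
      (⋂ t : ℝ, {p | dist (p.1.1 t) (p.2.1 t) = dist (p.1.1 0) (p.2.1 0)}) ∩
        ⋂ t : ℝ, {p | dist (p.2.1 0) (p.1.1 0) ≤ dist (p.2.1 0) (p.1.1 t)} := by
    ext ⟨v, w⟩
    simp only [mem_inter_iff, mem_iInter]
    constructor
    · rintro ⟨⟨c, hc⟩, -, h2⟩
      exact ⟨fun t => (hc t).trans (hc 0).symm, h2⟩
    · rintro ⟨h1, h2⟩
      have hw : w ∈ parallelSet v := ⟨_, h1⟩
      exact ⟨hw, ⟨w, hw, mem_range_self 0⟩, h2⟩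
  have c1 (t : ℝ) : Continuous fun p : GeodesicSpace X × GeodesicSpace X => p.1.1 t :=
    (continuous_eval t).comp continuous_fst
  have c2 (t : ℝ) : Continuous fun p : GeodesicSpace X × GeodesicSpace X => p.2.1 t :=
    (continuous_eval t).comp continuous_snd
  rw [h]
  exact (isClosed_iInter fun t => isClosed_eq ((c1 t).dist (c2 t)) ((c1 0).dist (c2 0))).inter
    (isClosed_iInter fun t => isClosed_le ((c2 0).dist (c1 0)) ((c2 0).dist (c1 t)))

/-- The geodesics whose cross section meets a given compact set form a closed set. -/
theorem isClosed_setOf_crossSectionG_inter {K : Set (GeodesicSpace X)} (hK : IsCompact K) :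
    IsClosed {v : GeodesicSpace X | (crossSectionG v ∩ K).Nonempty} := by
  have : CompactSpace K := isCompact_iff_compactSpace.1 hK
  convert isClosedMap_fst_of_compactSpace (X := GeodesicSpace X) (Y := K) _
    (isClosed_graph_crossSectionG.preimage (continuous_id.prodMap continuous_subtype_val)) using 1
  ext v
  constructor
  · rintro ⟨w, hw, hwK⟩
    exact ⟨(v, ⟨w, hwK⟩), hw, rfl⟩
  · rintro ⟨⟨_, w⟩, hw, rfl⟩
    exact ⟨w, hw, w.2⟩

/-- The geodesics with footpoint in a given ball form a compact set. -/
theorem isCompact_setOf_dist_le [ProperSpace X] (x : X) (r : ℝ) :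
    IsCompact {w : GeodesicSpace X | dist (w.1 0) x ≤ r} := by
  rw [Subtype.isCompact_iff]
  refine ArzelaAscoli.isCompact_of_equicontinuous _ ?_ ?_
  · have hK : IsCompact (Set.pi univ fun t : ℝ => Metric.closedBall x (|t| + r)) :=
      isCompact_univ_pi fun t => isCompact_closedBall _ _
    refine hK.of_isClosed_subset ?_ ?_
    · have h : ContinuousMap.toFun '' (Subtype.val '' {w : GeodesicSpace X | dist (w.1 0) x ≤ r}) =
          (⋂ s : ℝ, ⋂ t : ℝ, {f : ℝ → X | dist (f s) (f t) = dist s t}) ∩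
            {f : ℝ → X | dist (f 0) x ≤ r} := by
        ext f
        simp only [mem_inter_iff, mem_iInter]
        constructor
        · rintro ⟨_, ⟨w, hw, rfl⟩, rfl⟩
          exact ⟨fun s t => w.2.dist_eq s t, hw⟩
        · rintro ⟨h1, h2⟩
          have hf : Isometry f := Isometry.of_dist_eq h1
          exact ⟨⟨f, hf.continuous⟩, ⟨⟨⟨f, hf.continuous⟩, hf⟩, h2, rfl⟩, rfl⟩
      rw [h]
      refine (isClosed_iInter fun s => isClosed_iInter fun t => ?_).inter ?_
      · exact isClosed_eq ((continuous_apply s).dist (continuous_apply t)) continuous_const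
      · exact isClosed_le ((continuous_apply 0).dist continuous_const) continuous_const
    · rintro _ ⟨_, ⟨w, hw, rfl⟩, rfl⟩ t -
      have h1 : dist (w.1 t) (w.1 0) = |t| := by rw [w.2.dist_eq, Real.dist_eq, sub_zero]
      have h2 : dist (w.1 0) x ≤ r := hw
      exact (dist_triangle (w.1 t) (w.1 0) x).trans (by rw [h1]; linarith)
  · refine Metric.equicontinuous_of_continuity_modulus id tendsto_id _ ?_
    rintro s t ⟨_, w, -, rfl⟩
    exact (w.2.dist_eq s t).le

end GeodesicSpace
end CAT0


/-! ### Approachability as lower hemicontinuity -/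

namespace GeodesicSpace

variable {X : Type*} [MetricSpace X]

instance : FirstCountableTopology (GeodesicSpace X) :=
  have : PseudoMetrizableSpace C(ℝ, X) := inferInstance
  have : FirstCountableTopology C(ℝ, X) := inferInstance
  Subtype.firstCountableTopology _

theorem completelyApproachable_iff_eventually {v : GeodesicSpace X} :
    v.CompletelyApproachable ↔
      ∀ x ∈ crossSection v, ∀ ε > 0, ∀ᶠ u in 𝓝 v, ∃ y ∈ crossSection u, dist x y < ε := by
  refine forall₂_congr fun x _ => ⟨fun h ε hε => ?_, fun h u hu => ?_⟩
  · rw [eventually_iff_seq_eventually]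
    intro u hu
    obtain ⟨y, hy, hyu⟩ := h u hu
    filter_upwards [hy (Metric.ball_mem_nhds x hε)] with n hn
    exact ⟨y n, hyu n, by rwa [dist_comm]⟩
  · have hne (n : ℕ) : (crossSection (u n)).Nonempty := ⟨_, self_mem_crossSection (u n)⟩
    have hpos (n : ℕ) : (0 : ℝ) < 1 / (n + 1) := Nat.one_div_pos_of_nat
    -- Choosing `y n` nearly closest to `x` makes a single sequence work for every `ε`.
    choose y hyu hy using fun n : ℕ =>
      (Metric.infDist_lt_iff (x := x) (hne n)).1 (lt_add_of_pos_right _ (hpos n))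
    refine ⟨y, ?_, hyu⟩
    rw [Metric.tendsto_atTop']
    intro ε hε
    obtain ⟨N, hN⟩ := ((hu.eventually (h (ε / 2) (half_pos hε))).and
      (tendsto_one_div_add_atTop_nhds_zero_nat.eventually_lt_const
        (half_pos hε))).exists_forall_of_atTop
    refine ⟨N, fun n hn => ?_⟩
    obtain ⟨⟨z, hz, hxz⟩, hn'⟩ := hN n hn.le
    rw [dist_comm]
    linarith [hy n, Metric.infDist_le_dist_of_mem (x := x) hz]

/-- Complete approachability is lower hemicontinuity of the cross section in `GX`. -/
theorem completelyApproachable_iff_crossSectionG [ProperSpace X] (hX : IsCAT0 X)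
    {v : GeodesicSpace X} :
    v.CompletelyApproachable ↔ ∀ U : Set (GeodesicSpace X), IsOpen U →
      (crossSectionG v ∩ U).Nonempty → ∀ᶠ u in 𝓝 v, (crossSectionG u ∩ U).Nonempty := by
  rw [completelyApproachable_iff_eventually]
  constructor
  · rintro h U hU ⟨w, hw, hwU⟩
    have hcomp (r : ℝ) : IsCompact ({w' : GeodesicSpace X | dist (w'.1 0) (w.1 0) ≤ r} \ U) :=
      (isCompact_setOf_dist_le _ _).diff hU
    -- Only `w` itself has footpoint `w(0)` in `CS_v`, so by compactness the members of `CS_v`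
    -- outside `U` have footpoints bounded away from `w(0)`.
    obtain ⟨δ, hδ, hδv⟩ : ∃ δ > 0, ¬ (crossSectionG v ∩
        ({w' : GeodesicSpace X | dist (w'.1 0) (w.1 0) ≤ δ} \ U)).Nonempty := by
      set K := crossSectionG v ∩ ({w' : GeodesicSpace X | dist (w'.1 0) (w.1 0) ≤ 1} \ U)
      have hK : IsCompact K := (hcomp 1).inter_left (isClosed_crossSectionG v)
      rcases K.eq_empty_or_nonempty with hK0 | hK0
      · exact ⟨1, one_pos, not_nonempty_iff_eq_empty.2 hK0⟩
      · obtain ⟨w₀, hw₀, hmin⟩ := hK.exists_isMinOn hK0 (f := fun w' => dist (w'.1 0) (w.1 0))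
          ((continuous_eval 0).dist continuous_const).continuousOn
        have hpos : 0 < dist (w₀.1 0) (w.1 0) := by
          refine dist_pos.2 fun h0 => hw₀.2.2 ?_
          rwa [eq_of_parallel hX hw₀.1.1 hw.1 h0]
        refine ⟨min 1 (dist (w₀.1 0) (w.1 0) / 2), lt_min one_pos (half_pos hpos), ?_⟩
        rintro ⟨w', hw', hd, hU'⟩
        rw [mem_ofPred_eq, le_min_iff] at hd
        have h1 : dist (w₀.1 0) (w.1 0) ≤ dist (w'.1 0) (w.1 0) := hmin ⟨hw', hd.1, hU'⟩
        have h2 := hd.2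
        linarith
    -- The second condition extends this gap to nearby `u`: a member of `CS_u` with footpoint within
    -- `δ` of `w(0)` must lie in `U`.
    filter_upwards [h _ hw.2 δ hδ,
      (isClosed_setOf_crossSectionG_inter (hcomp δ)).isOpen_compl.mem_nhds hδv] with u hu hu'
    obtain ⟨y, hy, hxy⟩ := hu
    obtain ⟨w', hw', rfl⟩ := exists_crossSectionG hX hy
    refine ⟨w', hw', by_contra fun hU' => hu' ⟨w', hw', ?_, hU'⟩⟩
    rw [dist_comm] at hxy
    exact hxy.le
  · intro h x hx ε hε
    obtain ⟨w, hw, rfl⟩ := exists_crossSectionG hX hx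
    filter_upwards [h {w' | dist (w.1 0) (w'.1 0) < ε}
      (isOpen_lt (continuous_const.dist (continuous_eval 0)) continuous_const)
      ⟨w, hw, by simpa using hε⟩] with u hu
    obtain ⟨w', hw', hd⟩ := hu
    exact ⟨w'.1 0, hw'.2, hd⟩

theorem coe_extCrossSection (v : GeodesicSpace X) :
    (v.extCrossSection : Set (OnePoint (GeodesicSpace X))) =
      (fun w : GeodesicSpace X => (w : OnePoint (GeodesicSpace X))) '' crossSectionG v ∪
        {OnePoint.infty} := rfl

theorem upperHemicontinuous_extCrossSection :
    UpperHemicontinuous (fun v : GeodesicSpace X =>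
      (v.extCrossSection : Set (OnePoint (GeodesicSpace X)))) := by
  refine .of_forall_isOpen fun v U hU hvU => ?_
  have hinf : OnePoint.infty ∈ U := hvU (Or.inr rfl)
  have hK := ((OnePoint.isOpen_iff_of_mem hinf).1 hU).2
  have hiff (u : GeodesicSpace X) : (u.extCrossSection : Set (OnePoint (GeodesicSpace X))) ⊆ U ↔
      ¬ (crossSectionG u ∩ (OnePoint.some ⁻¹' U)ᶜ).Nonempty := by
    rw [coe_extCrossSection, union_subset_iff, image_subset_iff, singleton_subset_iff,
      inter_compl_nonempty_iff, not_not]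
    exact and_iff_left hinf
  simp only [hiff] at hvU ⊢
  exact (isClosed_setOf_crossSectionG_inter hK).isOpen_compl.mem_nhds hvU

end GeodesicSpace

/-! ### Continuity for the Hausdorff topology -/

/-- A map to the closed subsets of a compact Hausdorff space is continuous at a point for the
Hausdorff topology if and only if it is upper and lower hemicontinuous there. -/
theorem continuousAt_hausdorffTopology_iff {A Z : Type*} [TopologicalSpace A] [TopologicalSpace Z]
    [CompactSpace Z] [T2Space Z] {f : A → Closeds Z} {a : A} :
    @ContinuousAt _ _ _ (hausdorffTopology Z) f a ↔
      UpperHemicontinuousAt (fun x => (f x : Set Z)) a ∧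
        ∀ U : Set Z, IsOpen U → ((f a : Set Z) ∩ U).Nonempty →
          ∀ᶠ x in 𝓝 a, ((f x : Set Z) ∩ U).Nonempty := by
  let : UniformSpace Z := uniformSpaceOfCompactR1
  let : UniformSpace (Set Z) := UniformSpace.hausdorff Z
  change ContinuousAt f a ↔ _
  -- At a compact set, Hausdorff and Vietoris neighbourhoods agree; the latter are generated by the
  -- conditions of lying in, or meeting, an open set.
  rw [Closeds.isUniformEmbedding_coe.isEmbedding.continuousAt_iff, ContinuousAt,
    Function.comp_apply,
    (f a).isClosed.isCompact.nhds_hausdorff_eq_nhds_vietoris, nhds_generateFrom]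
  simp only [tendsto_iInf, tendsto_principal, upperHemicontinuousAt_iff_forall_isOpen]
  constructor
  · intro h
    exact ⟨fun U hU haU => h _ ⟨haU, .inl ⟨U, hU, rfl⟩⟩,
      fun U hU haU => h _ ⟨haU, .inr ⟨U, hU, rfl⟩⟩⟩
  · rintro ⟨h1, h2⟩ _ ⟨ha, ⟨U, hU, rfl⟩ | ⟨U, hU, rfl⟩⟩
    · exact h1 U hU ha
    · exact h2 U hU ha

namespace GeodesicSpace

variable {X : Type*} [MetricSpace X]

theorem completelyApproachable_iff_continuousAt [ProperSpace X] (hX : IsCAT0 X)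
    (v : GeodesicSpace X) :
    v.CompletelyApproachable ↔
      @ContinuousAt _ _ _ (hausdorffTopology (OnePoint (GeodesicSpace X)))
        (fun w : GeodesicSpace X => w.extCrossSection) v := by
  rw [continuousAt_hausdorffTopology_iff, completelyApproachable_iff_crossSectionG hX,
    and_iff_right (upperHemicontinuous_extCrossSection v)]
  constructor
  · rintro h U hU ⟨z, hz, hzU⟩
    rcases hz with ⟨w, hw, rfl⟩ | rfl
    · filter_upwards [h _ (hU.preimage OnePoint.continuous_coe) ⟨w, hw, hzU⟩] with u hu
      obtain ⟨w', hw', hU'⟩ := hu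
      exact ⟨_, Or.inl ⟨w', hw', rfl⟩, hU'⟩
    -- Every value contains `∞`, so lower hemicontinuity there is free.
    · exact .of_forall fun u => ⟨_, Or.inr rfl, hzU⟩
  · rintro h U hU ⟨w, hw, hwU⟩
    filter_upwards [h _ (OnePoint.isOpenMap_coe U hU)
      ⟨_, Or.inl ⟨w, hw, rfl⟩, mem_image_of_mem _ hwU⟩] with u hu
    obtain ⟨_, ⟨w', hw', rfl⟩ | rfl, w'', hw'', he⟩ := hu
    · exact ⟨w', hw', OnePoint.coe_injective he ▸ hw''⟩
    · exact absurd he (OnePoint.coe_ne_infty _)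

/-! ### Baire category -/

/-- The geodesics whose cross section in `X` meets a given closed ball form a closed set. -/
theorem isClosed_setOf_crossSection_inter_closedBall [ProperSpace X] (hX : IsCAT0 X) (x : X)
    (r : ℝ) :
    IsClosed {v : GeodesicSpace X | (crossSection v ∩ Metric.closedBall x r).Nonempty} := by
  convert isClosed_setOf_crossSectionG_inter (isCompact_setOf_dist_le x r) using 1
  ext v
  constructor
  · rintro ⟨y, hy, hyr⟩
    obtain ⟨w, hw, rfl⟩ := exists_crossSectionG hX hy
    exact ⟨w, hw, hyr⟩
  · rintro ⟨w, hw, hwr⟩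
    exact ⟨w.1 0, hw.2, hwr⟩

/-- For closed balls around the points `x i` of a dense sequence, `v` is completely approachable
if and only if, whenever its cross section meets one of them, the cross sections of the nearby
geodesics meet the ball of twice the radius. -/
theorem completelyApproachable_iff_denseRange {x : ℕ → X} (hx : DenseRange x)
    {v : GeodesicSpace X} :
    v.CompletelyApproachable ↔ ∀ p : ℕ × ℕ,
      (crossSection v ∩ Metric.closedBall (x p.1) (1 / (p.2 + 1))).Nonempty →
        v ∈ interior {u : GeodesicSpace X |
          (crossSection u ∩ Metric.closedBall (x p.1) (2 * (1 / (p.2 + 1)))).Nonempty} := by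
  rw [completelyApproachable_iff_eventually]
  constructor
  · rintro h ⟨i, n⟩ ⟨y, hy, hyi⟩
    rw [mem_interior_iff_mem_nhds]
    filter_upwards [h y hy (1 / (n + 1)) Nat.one_div_pos_of_nat] with u hu
    obtain ⟨z, hz, hyz⟩ := hu
    refine ⟨z, hz, ?_⟩
    rw [Metric.mem_closedBall] at hyi ⊢
    linarith [dist_triangle_left z (x i) y]
  · intro h y hy ε hε
    obtain ⟨n, hn⟩ := exists_nat_one_div_lt (show 0 < ε / 3 by linarith)
    obtain ⟨i, hi⟩ := hx.exists_dist_lt y (ε := 1 / ((n : ℝ) + 1)) Nat.one_div_pos_of_nat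
    filter_upwards [mem_interior_iff_mem_nhds.1 (h (i, n) ⟨y, hy, hi.le⟩)] with u hu
    obtain ⟨z, hz, hzi⟩ := hu
    rw [Metric.mem_closedBall] at hzi
    exact ⟨z, hz, by linarith [dist_triangle_right y z (x i)]⟩

theorem isGδ_and_dense_completelyApproachable [ProperSpace X] (hX : IsCAT0 X) :
    IsGδ {v : GeodesicSpace X | v.CompletelyApproachable} ∧
      Dense {v : GeodesicSpace X | v.CompletelyApproachable} := by
  rcases isEmpty_or_nonempty X with hXe | hXn
  · have : IsEmpty (GeodesicSpace X) := ⟨fun v => hXe.elim (v.1 0)⟩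
    exact ⟨by rw [eq_empty_of_isEmpty {v : GeodesicSpace X | _}]; exact .empty, isEmptyElim⟩
  obtain ⟨x, hx⟩ := exists_dense_seq X
  let A (i : ℕ) (r : ℝ) : Set (GeodesicSpace X) :=
    {v | (crossSection v ∩ Metric.closedBall (x i) r).Nonempty}
  have hA (i : ℕ) (r : ℝ) : IsClosed (A i r) :=
    isClosed_setOf_crossSection_inter_closedBall hX (x i) r
  let W (p : ℕ × ℕ) : Set (GeodesicSpace X) :=
    (A p.1 (1 / (p.2 + 1)))ᶜ ∪ interior (A p.1 (2 * (1 / (p.2 + 1))))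
  have hW : {v : GeodesicSpace X | v.CompletelyApproachable} = ⋂ p, W p := by
    ext v
    rw [mem_iInter]
    exact (completelyApproachable_iff_denseRange hx).trans (forall_congr' fun p => imp_iff_not_or)
  have hopen (p : ℕ × ℕ) : IsOpen (W p) := (hA _ _).isOpen_compl.union isOpen_interior
  rw [hW]
  refine ⟨.iInter_of_isOpen hopen, dense_iInter_of_isOpen hopen fun p => ?_⟩
  -- `W p` contains the complement of the frontier of a closed set: a point of that set off its
  -- frontier is interior to it, hence interior to the set for the doubled radius.
  refine Dense.mono ?_
    (interior_eq_empty_iff_dense_compl.1 (interior_frontier (hA p.1 (1 / (p.2 + 1)))))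
  intro v hv
  refine or_iff_not_imp_left.2 fun hvA => interior_mono ?_ (by_contra fun hvi =>
    hv ((hA _ _).frontier_eq ▸ ⟨not_not.1 hvA, hvi⟩))
  have hpos : (0 : ℝ) < 1 / ((p.2 : ℝ) + 1) := Nat.one_div_pos_of_nat
  exact fun u hu => hu.mono (inter_subset_inter_right _ (Metric.closedBall_subset_closedBall
    (by linarith)))

end GeodesicSpace

theorem mainTheorem6 (X : Type*) [MetricSpace X] [ProperSpace X] (hX : IsCAT0 X) :
    (IsGδ {v : GeodesicSpace X | v.CompletelyApproachable} ∧
      Dense {v : GeodesicSpace X | v.CompletelyApproachable}) ∧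
    UpperHemicontinuous (fun v : GeodesicSpace X =>
      (v.extCrossSection : Set (OnePoint (GeodesicSpace X)))) ∧
    ∀ v : GeodesicSpace X, v.CompletelyApproachable ↔
      @ContinuousAt _ _ _ (hausdorffTopology (OnePoint (GeodesicSpace X)))
        (fun w : GeodesicSpace X => w.extCrossSection) v :=
  ⟨GeodesicSpace.isGδ_and_dense_completelyApproachable hX,
    GeodesicSpace.upperHemicontinuous_extCrossSection,
    GeodesicSpace.completelyApproachable_iff_continuousAt hX⟩
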